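/- **Proposition.** Consider the formulae of linear logic without propositional variables (with $\wp$ for the connective par), $$A ::= 0 \mid 1 \mid A\otimes A \mid A\oplus A \mid {?}A \mid \top \mid \bot \mid A \wp A \mid A \mathbin{\&} A \mid {!}A ,$$ where the first five forms are called positive and the other ones negative, and let $A^\bot$ be the linear negation (De Morgan dual) of $A$. Let $\wp ^0A=\bot$, $\wp ^{n+1}A=(\wp ^nA)\wp A$, $\otimes^0A=1$, $\otimes^{n+1}A=(\otimes^nA)\otimes A$. Sequents are lists of formulae. *LL* is the usual one-sided sequent calculus of linear logic. *LLTN* has the exchange rule, the cut rule, the usual rules for $1,\bot,\top,\wp ,\oplus,\&$, and the rules $$\frac{\Gamma,{?}\Theta,A\qquad \Delta,{?}\Theta,B}{\Gamma,\Delta,{?}\Theta,A\otimes B}\qquad \frac{\Gamma,\wp ^nA}{\Gamma,{?}A}\ (n\in\mathbb N)\qquad \frac{\Gamma,\otimes^nA\ \text{ for all } n\in\mathbb N}{\Gamma,{!}A};$$ its proofs are the (possibly infinitely branching) trees all of whose branches are finite. A *position* is a finite directed tree (a directed graph whose underlying undirected graph is a tree) with edges labelled by positive formulae, in which every vertex is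 a proponent or an opponent and one vertex holds the token. A tree with some negative labels denotes the one obtained by reversing each negatively labelled edge and dualising its label. A *move* is made by the vertex $v$ that holds the token, on one edge between $v$ and another vertex $w$, and gives the token to $w$; vertices keep their signs, copies of a vertex inherit its sign, and what is not mentioned is unchanged (moves are taken up to isomorphism of positions): * if there is an edge from $w$ to $v$, nothing else changes; * if the edge from $v$ to $w$ is labelled $1$ and is the only edge at $v$, then $v$ and this edge are deleted; * if the edge from $v$ to $w$ is labelled $A\oplus B$, its label becomes $A$, or becomes $B$; * if the edge from $v$ to $w$ is labelled ${?}(A^\bot)$, it is replaced, for some $n\in\mathbb N$, with an edge from $w$ to $v$ labelled $\otimes^nA$; * if the edge from $v$ to $w$ is labelled $A\otimes B$, the other neighbours of $v$ are partitioned into sets $\Gamma,\Gamma',\Theta$ (possibly empty), where each $n\in\Theta$ is reached by an edge from $v$ to $n$ with a label of the form ${?}C$; the edge is deleted and $v$ is replaced with two vertices $v_1,v_2$, with new edges from $v_1$ to $w$ labelled $A$ and from $v_2$ to $w$ labelled $B$; the subtrees that hang from $v$ through $\Gamma$ are attached to $v_1$, those through $\Gamma'$ to $v_2$, and one copy of those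 through $\Theta$ to each of $v_1$ and $v_2$. A *play* from $U$ is a finite path of moves starting at $U$. A *strategy* on $U$ is a set of plays from $U$ that contains the empty play, is closed under prefixes, contains with a play that ends in a position where an opponent holds the token all its extensions by one move, and contains with a play all plays from $U$ isomorphic to it (of the same length, with isomorphic positions). It is *winning* if, at the end of each of its maximal plays (those with no proper extension in the strategy), an opponent holds the token. For rooted trees $T,T'$ (finite, directed, with positively labelled edges), put an edge labelled $A$ from the root of $T$ to the root of $T'$, and let the vertices of $T$ be proponents and those of $T'$ opponents. The formula $A$ is *GLLTN-valid* if there is a $T$ such that for all $T'$ and all placements of the token on a vertex of $T$ or of $T'$ there is a winning strategy on the position so obtained. Then GLLTN-validity is complete neither with respect to LL nor with respect to LLTN: it is not the case that each GLLTN-valid formula is provable in LL, and it is not the case that each GLLTN-valid formula is provable in LLTN. Specifically, $\bot\otimes\bot$ is GLLTN-valid, but is provable neither in LL nor in LLTN. -/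

import Mathlib

namespace LinLogic

/-! ### Formulae and sequent calculi -/

/-- Formulae of linear logic without propositional variables. -/
inductive Formula : Type where
  | zero : Formula
  | one : Formula
  | tensor : Formula → Formula → Formula
  | plus : Formula → Formula → Formula
  | whyNot : Formula → Formula
  | top : Formula
  | bot : Formula
  | par : Formula → Formula → Formula
  | amp : Formula → Formula → Formula
  | bang : Formula → Formula

namespace Formula

/-- Linear negation. -/
def dual : Formula → Formula
  | zero => top
  | one => bot
  | tensor A B => par A.dual B.dual
  | plus A B => amp A.dual B.dual
  | whyNot A => bang A.dual
  | top => zero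
  | bot => one
  | par A B => tensor A.dual B.dual
  | amp A B => plus A.dual B.dual
  | bang A => whyNot A.dual

/-- The positive formulae; the other ones are negative. -/
def IsPositive : Formula → Prop
  | zero => True
  | one => True
  | tensor _ _ => True
  | plus _ _ => True
  | whyNot _ => True
  | top => False
  | bot => False
  | par _ _ => False
  | amp _ _ => False
  | bang _ => False

/-- The `n`-fold tensor power: `1` for `n = 0`, then `(A ^ n) ⊗ A`. -/
def tensorPow (A : Formula) : ℕ → Formula
  | 0 => one
  | n + 1 => tensor (tensorPow A n) A

/-- The `n`-fold par power: `⊥` for `n = 0`, then (the `n`-fold power of `A`) par `A`. -/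
def parPow (A : Formula) : ℕ → Formula
  | 0 => bot
  | n + 1 => par (parPow A n) A

theorem dual_isPositive_iff (A : Formula) : A.dual.IsPositive ↔ ¬ A.IsPositive := by
  cases A <;> simp [dual, IsPositive]

end Formula

open Formula

/-- Sequents are (one-sided) lists of formulae. -/
abbrev Sequent := List Formula

/-- Provability in the usual one-sided sequent calculus of linear logic (with identity, cut and
exchange). -/
inductive LLProvable : Sequent → Prop where
  | ax (A : Formula) : LLProvable [A, A.dual]
  | cut (Γ Δ : Sequent) (A : Formula) :
      LLProvable (Γ ++ [A]) → LLProvable (Δ ++ [A.dual]) → LLProvable (Γ ++ Δ)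
  | exchange (Γ Δ : Sequent) (A B : Formula) :
      LLProvable (Γ ++ B :: A :: Δ) → LLProvable (Γ ++ A :: B :: Δ)
  | one : LLProvable [one]
  | bot (Γ : Sequent) : LLProvable Γ → LLProvable (Γ ++ [bot])
  | top (Γ : Sequent) : LLProvable (Γ ++ [top])
  | tensor (Γ Δ : Sequent) (A B : Formula) :
      LLProvable (Γ ++ [A]) → LLProvable (Δ ++ [B]) → LLProvable (Γ ++ Δ ++ [tensor A B])
  | par (Γ : Sequent) (A B : Formula) :
      LLProvable (Γ ++ [A, B]) → LLProvable (Γ ++ [par A B])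
  | plusLeft (Γ : Sequent) (A B : Formula) :
      LLProvable (Γ ++ [A]) → LLProvable (Γ ++ [plus A B])
  | plusRight (Γ : Sequent) (A B : Formula) :
      LLProvable (Γ ++ [B]) → LLProvable (Γ ++ [plus A B])
  | amp (Γ : Sequent) (A B : Formula) :
      LLProvable (Γ ++ [A]) → LLProvable (Γ ++ [B]) → LLProvable (Γ ++ [amp A B])
  | dereliction (Γ : Sequent) (A : Formula) :
      LLProvable (Γ ++ [A]) → LLProvable (Γ ++ [whyNot A])
  | weakening (Γ : Sequent) (A : Formula) :
      LLProvable Γ → LLProvable (Γ ++ [whyNot A])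
  | contraction (Γ : Sequent) (A : Formula) :
      LLProvable (Γ ++ [whyNot A, whyNot A]) → LLProvable (Γ ++ [whyNot A])
  | promotion (Γ : Sequent) (A : Formula) :
      LLProvable (Γ.map whyNot ++ [A]) → LLProvable (Γ.map whyNot ++ [bang A])

/-- Provability in LLTN: the tensor rule shares formulae `?C` between its two premises, and the
exponentials have the rules of an infinitary `⊕` of par powers and an infinitary `&` of tensor
powers. Proofs are well-founded, infinitely branching trees; the cut rule is included. -/
inductive LLTNProvable : Sequent → Prop where
  | cut (Γ Δ : Sequent) (A : Formula) :
      LLTNProvable (Γ ++ [A]) → LLTNProvable (Δ ++ [A.dual]) → LLTNProvable (Γ ++ Δ)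
  | exchange (Γ Δ : Sequent) (A B : Formula) :
      LLTNProvable (Γ ++ B :: A :: Δ) → LLTNProvable (Γ ++ A :: B :: Δ)
  | one : LLTNProvable [one]
  | bot (Γ : Sequent) : LLTNProvable Γ → LLTNProvable (Γ ++ [bot])
  | top (Γ : Sequent) : LLTNProvable (Γ ++ [top])
  | tensor (Γ Δ Θ : Sequent) (A B : Formula) :
      LLTNProvable (Γ ++ Θ.map whyNot ++ [A]) → LLTNProvable (Δ ++ Θ.map whyNot ++ [B]) →
      LLTNProvable (Γ ++ Δ ++ Θ.map whyNot ++ [tensor A B])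
  | par (Γ : Sequent) (A B : Formula) :
      LLTNProvable (Γ ++ [A, B]) → LLTNProvable (Γ ++ [par A B])
  | plusLeft (Γ : Sequent) (A B : Formula) :
      LLTNProvable (Γ ++ [A]) → LLTNProvable (Γ ++ [plus A B])
  | plusRight (Γ : Sequent) (A B : Formula) :
      LLTNProvable (Γ ++ [B]) → LLTNProvable (Γ ++ [plus A B])
  | amp (Γ : Sequent) (A B : Formula) :
      LLTNProvable (Γ ++ [A]) → LLTNProvable (Γ ++ [B]) → LLTNProvable (Γ ++ [amp A B])
  | whyNot (Γ : Sequent) (A : Formula) (n : ℕ) :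
      LLTNProvable (Γ ++ [parPow A n]) → LLTNProvable (Γ ++ [whyNot A])
  | bang (Γ : Sequent) (A : Formula) :
      (∀ n : ℕ, LLTNProvable (Γ ++ [tensorPow A n])) → LLTNProvable (Γ ++ [bang A])

/-! ### Directed graphs with edges labelled by formulae -/

/-- A directed graph with vertices `V` and with edges labelled by formulae: `lab u v = some A`
means that there is an edge from `u` to `v`, labelled with `A`. -/
structure Net (V : Type) where
  lab : V → V → Option Formula

namespace Net

variable {V W : Type}

/-- The underlying undirected graph. -/
def graph (N : Net V) : SimpleGraph V :=
  SimpleGraph.fromRel fun u v => (N.lab u v).isSome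

/-- The net is a (finite) tree: its underlying graph is a tree, without loops or pairs of opposite
edges (which `graph` does not see). -/
structure IsTree (N : Net V) : Prop where
  finite : Finite V
  asymm : ∀ u v, (N.lab u v).isSome → N.lab v u = none
  tree : N.graph.IsTree

/-- All labels are positive. -/
def IsNormal (N : Net V) : Prop :=
  ∀ u v A, N.lab u v = some A → A.IsPositive

open Classical in
/-- Normalisation: every edge with a negative label is reversed, and its label is replaced with
its dual. -/
noncomputable def normalise (N : Net V) : Net V where
  lab u v :=
    if ∃ A, N.lab u v = some A ∧ A.IsPositive then N.lab u v
    else if ∃ A, N.lab v u = some A ∧ ¬ A.IsPositive then (N.lab v u).map Formula.dual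
    else none

/-- Disjoint union. -/
def disjUnion (M : Net V) (N : Net W) : Net (V ⊕ W) where
  lab x y := match x, y with
    | Sum.inl u, Sum.inl v => M.lab u v
    | Sum.inr u, Sum.inr v => N.lab u v
    | _, _ => none

/-- The subgraph induced on a set of vertices. -/
def induce (N : Net V) (S : Set V) : Net S where
  lab u v := N.lab u v

open Classical in
/-- Removal of the edge from `u` to `v`. -/
noncomputable def removeEdge (N : Net V) (u v : V) : Net V where
  lab x y := if x = u ∧ y = v then none else N.lab x y

open Classical in
/-- Addition of an edge from `u` to `v` labelled with `A`. -/
noncomputable def addEdge (N : Net V) (u v : V) (A : Formula) : Net V where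
  lab x y := if x = u ∧ y = v then some A else N.lab x y

/-- For neighbours `v` and `n`: the vertices on the side of `n`, once the edge between `v` and `n`
has been deleted. -/
def side (N : Net V) (v n : V) : Set V :=
  {x | (N.graph.deleteEdges {s(v, n)}).Reachable n x}

/-- The subtree with root `v` that consists of `v` and of everything that hangs from `v` through
the neighbours in `S`. -/
def branch (N : Net V) (v : V) (S : Set V) : Set V :=
  {x | x = v ∨ ∃ n ∈ S, x ∈ N.side v n}

theorem root_mem_branch (N : Net V) (v : V) (S : Set V) : v ∈ N.branch v S := Or.inl rfl

theorem mem_side_self (N : Net V) (v n : V) : n ∈ N.side v n := SimpleGraph.Reachable.refl n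

theorem IsTree.ne_of_lab {N : Net V} (h : N.IsTree) {u v : V} {A : Formula}
    (huv : N.lab u v = some A) : v ≠ u := by
  rintro rfl
  have := h.asymm v v (by simp [huv])
  simp [huv] at this

end Net

/-! ### Positions -/

/-- The two teams. -/
inductive Player : Type where
  | proponent : Player
  | opponent : Player

/-- A net with a sign for each vertex and a distinguished vertex holding the token. -/
structure SignedNet where
  V : Type
  net : Net V
  sign : V → Player
  token : V

/-- Normalisation of the labels. -/
noncomputable def SignedNet.normalise (P : SignedNet) : SignedNet where
  V := P.V
  net := P.net.normalise
  sign := P.sign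
  token := P.token

/-- Existence of an isomorphism, preserving edges, labels, signs and the token. -/
def SignedNet.Iso (P Q : SignedNet) : Prop :=
  ∃ e : P.V ≃ Q.V, (∀ u v, P.net.lab u v = Q.net.lab (e u) (e v)) ∧
    (∀ u, P.sign u = Q.sign (e u)) ∧ e P.token = Q.token

/-- A position: a punctured, directed, signed, normally labelled tree. -/
structure Position extends SignedNet where
  isTree : net.IsTree
  isNormal : net.IsNormal

namespace Position

/-- The player whose turn it is. -/
def active (P : Position) : Player := P.sign P.token

/-! ### Moves

The next definitions give the targets of moves, before normalisation. Signs are inherited. -/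

/-- The underlying net is replaced with `N` on the same vertices, and `w` gets the token. -/
def passTo (P : Position) (N : Net P.V) (w : P.V) : SignedNet where
  V := P.V
  net := N
  sign := P.sign
  token := w

/-- Target of a `1`-move: the active vertex is deleted, and `w` gets the token. -/
def afterOne (P : Position) (w : P.V) (hw : w ≠ P.token) : SignedNet where
  V := {x : P.V | x ≠ P.token}
  net := P.net.induce {x | x ≠ P.token}
  sign x := P.sign x.1
  token := ⟨w, hw⟩

/-- Target of a tensor move along an edge from the active vertex `v` to `w`, labelled with
`A ⊗ B`. It consists of a first copy of `v` (which keeps what hangs through `Γ` and `Θ`), a second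
copy of `v` (which keeps what hangs through `Γ'` and `Θ`), and the side of `w`, with an edge
labelled `A` from the first copy of `v` to `w`, and an edge labelled `B` from the second copy of
`v` to `w`. -/
noncomputable def afterTensor (P : Position) (w : P.V) (A B : Formula) (Γ Γ' Θ : Set P.V) :
    SignedNet where
  V := P.net.branch P.token (Γ ∪ Θ) ⊕ P.net.branch P.token (Γ' ∪ Θ) ⊕ P.net.side P.token w
  net :=
    (((P.net.induce _).disjUnion ((P.net.induce _).disjUnion (P.net.induce _))).addEdge
      (Sum.inl ⟨P.token, P.net.root_mem_branch _ _⟩)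
      (Sum.inr (Sum.inr ⟨w, P.net.mem_side_self _ _⟩)) A).addEdge
      (Sum.inr (Sum.inl ⟨P.token, P.net.root_mem_branch _ _⟩))
      (Sum.inr (Sum.inr ⟨w, P.net.mem_side_self _ _⟩)) B
  sign := Sum.elim (fun x => P.sign x.1) (Sum.elim (fun x => P.sign x.1) (fun x => P.sign x.1))
  token := Sum.inr (Sum.inr ⟨w, P.net.mem_side_self _ _⟩)

/-- `Q` is isomorphic to the normalisation of `N`. -/
def Is (Q : Position) (N : SignedNet) : Prop := Q.toSignedNet.Iso N.normalise

end Position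

/-- The moves of the game, as a relation between positions. -/
inductive Move (P Q : Position) : Prop where
  /-- The active vertex passes the token along an input edge. -/
  | negative (w : P.V) (A : Formula) (h : P.net.lab w P.token = some A)
      (hQ : Q.Is (P.passTo P.net w)) : Move P Q
  /-- The active vertex deletes itself, along its only adjacent edge. -/
  | one (w : P.V) (h : P.net.lab P.token w = some Formula.one)
      (hsole : ∀ x, P.net.graph.Adj P.token x → x = w)
      (hQ : Q.Is (P.afterOne w (P.isTree.ne_of_lab h))) : Move P Q
  /-- The active vertex splits into two vertices. -/
  | tensor (w : P.V) (A B : Formula) (Γ Γ' Θ : Set P.V)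
      (h : P.net.lab P.token w = some (Formula.tensor A B))
      (hcover : Γ ∪ Γ' ∪ Θ = P.net.graph.neighborSet P.token \ {w})
      (hΓΓ' : Disjoint Γ Γ') (hΓΘ : Disjoint Γ Θ) (hΓ'Θ : Disjoint Γ' Θ)
      (hΘ : ∀ n ∈ Θ, ∃ C, P.net.lab P.token n = some (Formula.whyNot C))
      (hQ : Q.Is (P.afterTensor w A B Γ Γ' Θ)) : Move P Q
  | plusLeft (w : P.V) (A B : Formula) (h : P.net.lab P.token w = some (Formula.plus A B))
      (hQ : Q.Is (P.passTo ((P.net.removeEdge P.token w).addEdge P.token w A) w)) : Move P Q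
  | plusRight (w : P.V) (A B : Formula) (h : P.net.lab P.token w = some (Formula.plus A B))
      (hQ : Q.Is (P.passTo ((P.net.removeEdge P.token w).addEdge P.token w B) w)) : Move P Q
  /-- An output edge labelled with `?A^⊥` is replaced with a reverse edge labelled with the
  `n`-fold tensor power of `A`. -/
  | whyNot (w : P.V) (A : Formula) (n : ℕ)
      (h : P.net.lab P.token w = some (Formula.whyNot A.dual))
      (hQ : Q.Is (P.passTo ((P.net.removeEdge P.token w).addEdge w P.token (A.tensorPow n)) w)) :
      Move P Q

/-! ### Plays and strategies -/

/-- `l` is a play from `U`: a finite path of moves, given by the list of its positions after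
`U`. -/
def IsPlay (U : Position) (l : List Position) : Prop := List.IsChain Move (U :: l)

/-- The last position of a play from `U`. -/
def lastPosition (U : Position) (l : List Position) : Position := l.getLastD U

/-- A strategy on `U`: a set of plays from `U` that contains the empty play, is prefix-closed,
welcoming (it accepts all moves by opponents) and stable under isomorphism of plays. -/
structure IsStrategy (U : Position) (S : Set (List Position)) : Prop where
  isPlay : ∀ l ∈ S, IsPlay U l
  nil_mem : [] ∈ S
  prefix_mem : ∀ l ∈ S, ∀ l', l' <+: l → l' ∈ S
  welcoming : ∀ l ∈ S, (lastPosition U l).active = Player.opponent →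
    ∀ Q, Move (lastPosition U l) Q → l ++ [Q] ∈ S
  iso_mem : ∀ l ∈ S, ∀ l', IsPlay U l' →
    List.Forall₂ (fun P Q : Position => P.toSignedNet.Iso Q.toSignedNet) l l' → l' ∈ S

/-- `l` is maximal in `S`: it belongs to `S`, which contains no (proper) extension of it. -/
def IsMaximalIn (S : Set (List Position)) (l : List Position) : Prop :=
  l ∈ S ∧ ∀ l' ∈ S, l <+: l' → l' = l

/-- A winning strategy (for the proponents): in all maximal positions, the token is held by an
opponent. -/
def IsWinning (U : Position) (S : Set (List Position)) : Prop :=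
  IsStrategy U S ∧ ∀ l, IsMaximalIn S l → (lastPosition U l).active = Player.opponent

/-! ### Validity -/

/-- A rooted, directed, normally labelled tree. -/
structure RootedTree where
  V : Type
  net : Net V
  root : V
  isTree : net.IsTree
  isNormal : net.IsNormal

/-- The net obtained from two rooted trees by adding an edge labelled with `A` from the root of
the first one to the root of the second one (before normalisation). -/
noncomputable def joinNet (T T' : RootedTree) (A : Formula) : Net (T.V ⊕ T'.V) :=
  (T.net.disjUnion T'.net).addEdge (Sum.inl T.root) (Sum.inr T'.root) A

theorem Net.normalise_isNormal {V : Type} (N : Net V) : N.normalise.IsNormal := by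
  intro u v A h
  simp only [Net.normalise] at h
  split_ifs at h with h1 h2
  · obtain ⟨B, hB, hp⟩ := h1
    rw [hB] at h
    cases h
    exact hp
  · obtain ⟨B, hB, hp⟩ := h2
    rw [hB] at h
    simp only [Option.map_some, Option.some.injEq] at h
    subst h
    exact (Formula.dual_isPositive_iff B).2 hp

theorem Net.isSome_normalise {V : Type} (N : Net V) (u v : V) : (N.normalise.lab u v).isSome ↔
      (∃ A, N.lab u v = some A ∧ A.IsPositive) ∨ (∃ A, N.lab v u = some A ∧ ¬ A.IsPositive) := by
  simp only [Net.normalise]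
  split_ifs with h1 h2
  · obtain ⟨A, hA, hp⟩ := h1
    simp only [hA, Option.isSome_some, true_iff]
    exact Or.inl ⟨A, rfl, hp⟩
  · obtain ⟨A, hA, hp⟩ := h2
    simp only [hA, Option.map_some, Option.isSome_some, true_iff]
    exact Or.inr ⟨A, rfl, hp⟩
  · simp only [Option.isSome_none, Bool.false_eq_true, false_iff]
    exact fun h3 => h3.elim h1 h2

theorem Net.IsTree.normalise {V : Type} {N : Net V} (h : N.IsTree) : N.normalise.IsTree := by
  have key := N.isSome_normalise
  have hn : ∀ u v A, N.lab u v = some A → N.lab v u = none := fun u v A hA =>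
    h.asymm u v (by simp [hA])
  refine ⟨h.finite, fun u v huv => ?_, ?_⟩
  · by_contra hc
    have h2 : (N.normalise.lab v u).isSome := Option.isSome_iff_ne_none.2 hc
    rw [key] at huv h2
    rcases huv with ⟨A, hA, hp⟩ | ⟨A, hA, hp⟩ <;> rcases h2 with ⟨B, hB, hq⟩ | ⟨B, hB, hq⟩
    · have := hn _ _ _ hA; simp [this] at hB
    · rw [hA] at hB; cases hB; exact hq hp
    · rw [hA] at hB; cases hB; exact hp hq
    · have := hn _ _ _ hA; simp [this] at hB
  · have hg : N.normalise.graph = N.graph := by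
      ext u v
      change u ≠ v ∧ ((N.normalise.lab u v).isSome ∨ (N.normalise.lab v u).isSome) ↔
        u ≠ v ∧ ((N.lab u v).isSome ∨ (N.lab v u).isSome)
      rw [key, key, Option.isSome_iff_exists, Option.isSome_iff_exists]
      have e1 := fun A : Formula => Classical.em A.IsPositive
      constructor
      · rintro ⟨hne, (⟨A, hA, -⟩ | ⟨A, hA, -⟩) | (⟨A, hA, -⟩ | ⟨A, hA, -⟩)⟩
        exacts [⟨hne, Or.inl ⟨A, hA⟩⟩, ⟨hne, Or.inr ⟨A, hA⟩⟩, ⟨hne, Or.inr ⟨A, hA⟩⟩,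
          ⟨hne, Or.inl ⟨A, hA⟩⟩]
      · rintro ⟨hne, ⟨A, hA⟩ | ⟨A, hA⟩⟩ <;> rcases e1 A with hp | hp
        exacts [⟨hne, Or.inl (Or.inl ⟨A, hA, hp⟩)⟩, ⟨hne, Or.inr (Or.inr ⟨A, hA, hp⟩)⟩,
          ⟨hne, Or.inr (Or.inl ⟨A, hA, hp⟩)⟩, ⟨hne, Or.inl (Or.inr ⟨A, hA, hp⟩)⟩]
    rw [hg]
    exact h.tree

theorem isAcyclic_sum {V W : Type} {G : SimpleGraph V} {H : SimpleGraph W} (hG : G.IsAcyclic)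
    (hH : H.IsAcyclic) : (G ⊕g H).IsAcyclic := by
  rw [SimpleGraph.isAcyclic_iff_forall_adj_isBridge] at *
  have hl : ∀ (v v' : V) (x y : V ⊕ W),
      ((G ⊕g H).deleteEdges {s(Sum.inl v, Sum.inl v')}).Reachable x y →
      ∀ a, x = Sum.inl a → ∃ b, y = Sum.inl b ∧ (G.deleteEdges {s(v, v')}).Reachable a b := by
    rintro v v' x y ⟨p⟩
    induction p with
    | nil => intro a ha; exact ⟨a, ha, SimpleGraph.Reachable.refl _⟩
    | @cons x z y hxz p ih =>
      rintro a rfl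
      rcases z with z | z
      · obtain ⟨b, hb, hr⟩ := ih z rfl
        refine ⟨b, hb, SimpleGraph.Reachable.trans (SimpleGraph.Adj.reachable ?_) hr⟩
        simpa [SimpleGraph.deleteEdges_adj] using hxz
      · simp [SimpleGraph.deleteEdges_adj] at hxz
  have hr : ∀ (v v' : W) (x y : V ⊕ W),
      ((G ⊕g H).deleteEdges {s(Sum.inr v, Sum.inr v')}).Reachable x y →
      ∀ a, x = Sum.inr a → ∃ b, y = Sum.inr b ∧ (H.deleteEdges {s(v, v')}).Reachable a b := by
    rintro v v' x y ⟨p⟩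
    induction p with
    | nil => intro a ha; exact ⟨a, ha, SimpleGraph.Reachable.refl _⟩
    | @cons x z y hxz p ih =>
      rintro a rfl
      rcases z with z | z
      · simp [SimpleGraph.deleteEdges_adj] at hxz
      · obtain ⟨b, hb, hr⟩ := ih z rfl
        refine ⟨b, hb, SimpleGraph.Reachable.trans (SimpleGraph.Adj.reachable ?_) hr⟩
        simpa [SimpleGraph.deleteEdges_adj] using hxz
  rintro (v | v) (v' | v') hadj
  · rw [SimpleGraph.isBridge_iff]
    intro hreach
    obtain ⟨b, hb, hr'⟩ := hl v v' _ _ hreach v rfl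
    cases hb
    exact SimpleGraph.isBridge_iff.1 (hG (by simpa using hadj)) hr'
  · simp at hadj
  · simp at hadj
  · rw [SimpleGraph.isBridge_iff]
    intro hreach
    obtain ⟨b, hb, hr'⟩ := hr v v' _ _ hreach v rfl
    cases hb
    exact SimpleGraph.isBridge_iff.1 (hH (by simpa using hadj)) hr'

theorem joinNet_isTree (T T' : RootedTree) (A : Formula) : (joinNet T T' A).IsTree := by
  have hf := T.isTree.finite
  have hf' := T'.isTree.finite
  have hg : (joinNet T T' A).graph =
      (T.net.graph ⊕g T'.net.graph) ⊔ SimpleGraph.edge (Sum.inl T.root) (Sum.inr T'.root) := by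
    ext x y
    rcases x with x | x <;> rcases y with y | y
    · simp [joinNet, Net.graph, Net.addEdge, Net.disjUnion, SimpleGraph.edge_adj]
    · by_cases hxy : x = T.root ∧ y = T'.root <;>
        simp [joinNet, Net.graph, Net.addEdge, Net.disjUnion, SimpleGraph.edge_adj, hxy]
    · by_cases hxy : y = T.root ∧ x = T'.root
      · simp [joinNet, Net.graph, Net.addEdge, Net.disjUnion, SimpleGraph.edge_adj, hxy]
      · have hxy' : ¬ (x = T'.root ∧ y = T.root) := fun h => hxy h.symm
        simp [joinNet, Net.graph, Net.addEdge, Net.disjUnion, SimpleGraph.edge_adj, hxy, hxy']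
    · simp [joinNet, Net.graph, Net.addEdge, Net.disjUnion, SimpleGraph.edge_adj]
  refine ⟨inferInstance, ?_, ?_⟩
  · rintro (x | x) (y | y) h
    · have := T.isTree.asymm x y
      simp_all [joinNet, Net.addEdge, Net.disjUnion]
    · simp [joinNet, Net.addEdge, Net.disjUnion]
    · simp [joinNet, Net.addEdge, Net.disjUnion] at h
    · have := T'.isTree.asymm x y
      simp_all [joinNet, Net.addEdge, Net.disjUnion]
  · rw [hg]
    refine ⟨T.isTree.tree.connected.sum_sup_edge T'.isTree.tree.connected, ?_⟩
    exact (isAcyclic_sum T.isTree.tree.isAcyclic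
      T'.isTree.tree.isAcyclic).sup_edge_of_not_reachable
      (SimpleGraph.not_reachable_sum_inl_inr _ _)

/-- The position in which the proponents are the vertices of `T`, the opponents are those of `T'`,
an edge labelled with `A` goes from the root of `T` to the root of `T'`, and `t` holds the
token. -/
noncomputable def initialPosition (T T' : RootedTree) (A : Formula) (t : T.V ⊕ T'.V) :
    Position where
  V := T.V ⊕ T'.V
  net := (joinNet T T' A).normalise
  sign := Sum.elim (fun _ => Player.proponent) (fun _ => Player.opponent)
  token := t
  isTree := (joinNet_isTree T T' A).normalise
  isNormal := Net.normalise_isNormal _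

/-- GLLTN-validity of a formula: for some tree `T` and all trees `T'`, the vertices of `T` have a
winning strategy against those of `T'`, wherever the token is placed initially. -/
def GLLTNValid (A : Formula) : Prop :=
  ∃ T : RootedTree, ∀ T' : RootedTree, ∀ t : T.V ⊕ T'.V,
    ∃ S : Set (List Position), IsWinning (initialPosition T T' A t) S

end LinLogic

/-!
Classical truth (`⊗` and `&` as conjunction, `⅋` and `⊕` as disjunction, exponentials ignored) is
preserved by all rules of both calculi, and `⊥ ⊗ ⊥` is false.

For validity, a single vertex `p` suffices, and it never has to choose between moves. As soon as
`p` has the token, it splits into two vertices, each hanging from an opponent by a single edge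
labelled `⊥`, that is, by an input edge labelled `1`. To hand the token back along such an edge,
the opponent would have to delete itself, hence to have no other edge; but the tree is connected,
so this is impossible as long as there is another proponent. Opponents can copy such leaves but not
alter or delete them, and so the proponents never hold the token without being able to move.
-/

namespace LinLogic

open Formula

/-! ### Classical soundness of the sequent calculi -/

/-- The classical truth value of a formula, where the exponentials are ignored. -/
def Formula.Truth : Formula → Prop
  | zero => False
  | one => True
  | tensor A B => A.Truth ∧ B.Truth
  | plus A B => A.Truth ∨ B.Truth
  | whyNot A => A.Truth
  | top => True
  | bot => False
  | par A B => A.Truth ∨ B.Truth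
  | amp A B => A.Truth ∧ B.Truth
  | bang A => A.Truth

theorem Formula.truth_dual (A : Formula) : A.dual.Truth ↔ ¬ A.Truth := by
  induction A <;> simp_all only [dual, Truth] <;> tauto

theorem Formula.truth_of_truth_parPow {A : Formula} {n : ℕ} (h : (A.parPow n).Truth) :
    A.Truth := by
  induction n with
  | zero => exact h.elim
  | succ n ih => exact h.elim ih id

/-- The classical truth value of a sequent, read as the disjunction of its formulae. -/
def Sequent.Truth (Γ : Sequent) : Prop := ∃ A ∈ Γ, A.Truth

namespace Sequent

theorem truth_append (Γ Δ : Sequent) : Truth (Γ ++ Δ) ↔ Truth Γ ∨ Truth Δ := by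
  simp only [Truth, List.mem_append, or_and_right, exists_or]

theorem truth_cons (A : Formula) (Γ : Sequent) : Truth (A :: Γ) ↔ A.Truth ∨ Truth Γ := by
  simp only [Truth, List.mem_cons, or_and_right, exists_or, exists_eq_left]

theorem not_truth_nil : ¬ Truth [] := by
  simp only [Truth, List.not_mem_nil, false_and, exists_false, not_false_eq_true]

theorem truth_append_singleton (Γ : Sequent) (A : Formula) :
    Truth (Γ ++ [A]) ↔ Truth Γ ∨ A.Truth := by
  simp only [truth_append, truth_cons, not_truth_nil, or_false]

end Sequent

open Sequent in
theorem LLProvable.truth {Γ : Sequent} (h : LLProvable Γ) : Γ.Truth := by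
  induction h <;>
    simp only [truth_append, truth_cons, not_truth_nil, truth_dual, Formula.Truth] at * <;> tauto

open Sequent in
theorem LLTNProvable.truth {Γ : Sequent} (h : LLTNProvable Γ) : Γ.Truth := by
  induction h with
  | whyNot Γ A n _ ih =>
    rw [truth_append_singleton] at ih ⊢
    exact ih.imp_right (truth_of_truth_parPow (A := A))
  | bang Γ A _ ih =>
    have truth_tensorPow_one := (truth_append_singleton _ _).1 (ih 1)
    exact (truth_append_singleton _ _).2 (truth_tensorPow_one.imp_right And.right)
  | _ =>
    simp only [truth_append, truth_cons, not_truth_nil, truth_dual, Formula.Truth] at *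
    tauto

theorem not_truth_bot_tensor_bot : ¬ Sequent.Truth [tensor bot bot] := by
  simp only [Sequent.truth_cons, Sequent.not_truth_nil, Formula.Truth, and_self, or_self,
    not_false_eq_true]

theorem not_llProvable_bot_tensor_bot : ¬ LLProvable [tensor bot bot] :=
  fun h => not_truth_bot_tensor_bot h.truth

theorem not_lltnProvable_bot_tensor_bot : ¬ LLTNProvable [tensor bot bot] :=
  fun h => not_truth_bot_tensor_bot h.truth

/-! ### Links and leaves of nets -/

theorem Formula.dual_dual (A : Formula) : A.dual.dual = A := by
  induction A <;> simp_all only [dual]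

namespace Net

variable {V W : Type}

/-- There is an edge from `u` to `v` labelled with `A`, up to the identification of an edge
labelled with `A` and the reverse edge labelled with `A^⊥`. -/
def Links (N : Net V) (u v : V) (A : Formula) : Prop :=
  N.lab u v = some A ∨ N.lab v u = some A.dual

/-- `u` has no edges. -/
def IsIsolated (N : Net V) (u : V) : Prop := ∀ v A, ¬ N.Links u v A

/-- The only edge at `u` links it to `x`, with label `A`. -/
def IsLeaf (N : Net V) (u x : V) (A : Formula) : Prop :=
  ∀ y B, N.Links u y B ↔ y = x ∧ B = A

theorem links_dual_iff {N : Net V} {u v : V} {A : Formula} :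
    N.Links u v A.dual ↔ N.Links v u A := by
  rw [Links, Links, dual_dual, or_comm]

theorem exists_links_iff {N : Net V} {u v : V} :
    (∃ A, N.Links u v A) ↔ (N.lab u v).isSome ∨ (N.lab v u).isSome := by
  simp only [Links, exists_or, Option.isSome_iff_exists]
  exact or_congr_right
    ⟨fun ⟨A, hA⟩ => ⟨A.dual, hA⟩, fun ⟨A, hA⟩ => ⟨A.dual, by rw [dual_dual, hA]⟩⟩

theorem IsNormal.lab_of_links {N : Net V} (hN : N.IsNormal) {u v : V} {A : Formula}
    (h : N.Links u v A) (hA : A.IsPositive) : N.lab u v = some A :=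
  h.resolve_right fun h' => (dual_isPositive_iff A).1 (hN _ _ _ h') hA

theorem IsTree.ne_of_links {N : Net V} (hN : N.IsTree) {u v : V} {A : Formula}
    (h : N.Links u v A) : u ≠ v :=
  h.elim (fun h => (hN.ne_of_lab h).symm) hN.ne_of_lab

theorem IsTree.adj_of_links {N : Net V} (hN : N.IsTree) {u v : V} {A : Formula}
    (h : N.Links u v A) : N.graph.Adj u v :=
  ⟨hN.ne_of_links h, exists_links_iff.1 ⟨A, h⟩⟩

theorem exists_links_of_adj {N : Net V} {u v : V} (h : N.graph.Adj u v) : ∃ A, N.Links u v A :=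
  exists_links_iff.2 h.2

theorem links_of_lab_normalise {N : Net V} {u v : V} {A : Formula}
    (h : N.normalise.lab u v = some A) : N.Links u v A := by
  simp only [normalise] at h
  split_ifs at h with hpos hneg
  · exact Or.inl h
  · obtain ⟨B, hB, rfl⟩ := Option.map_eq_some_iff.1 h
    exact links_dual_iff.2 (Or.inl hB)

theorem Links.of_normalise {N : Net V} {u v : V} {A : Formula} (h : N.normalise.Links u v A) :
    N.Links u v A :=
  h.elim links_of_lab_normalise fun h => links_dual_iff.1 (links_of_lab_normalise h)

theorem Links.exists_normalise {N : Net V} {u v : V} {A : Formula} (h : N.Links u v A) :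
    ∃ B, N.normalise.Links u v B := by
  rw [exists_links_iff, N.isSome_normalise, N.isSome_normalise]
  by_cases hA : A.IsPositive
  · exact Or.inl (h.imp (fun h => ⟨A, h, hA⟩)
      fun h => ⟨A.dual, h, fun h' => (dual_isPositive_iff A).1 h' hA⟩)
  · exact Or.inr (h.symm.imp (fun h => ⟨A.dual, h, (dual_isPositive_iff A).2 hA⟩)
      fun h => ⟨A, h, hA⟩)

theorem links_addEdge_of_ne {N : Net V} {u y a b : V} {A B : Formula} (ha : u ≠ a)
    (hb : u ≠ b) : (N.addEdge a b B).Links u y A ↔ N.Links u y A := by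
  simp only [Links, addEdge, ha, hb, false_and, and_false, if_false]

theorem links_removeEdge_of_ne {N : Net V} {u y a b : V} {A : Formula} (ha : u ≠ a)
    (hb : u ≠ b) : (N.removeEdge a b).Links u y A ↔ N.Links u y A := by
  simp only [Links, removeEdge, ha, hb, false_and, and_false, if_false]

namespace IsLeaf

variable {N : Net V} {u x : V} {A : Formula}

theorem links (h : N.IsLeaf u x A) : N.Links u x A := (h x A).2 ⟨rfl, rfl⟩

theorem eq_of_adj (h : N.IsLeaf u x A) {y : V} (hy : N.graph.Adj u y) : y = x :=
  let ⟨_, hB⟩ := exists_links_of_adj hy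
  ((h _ _).1 hB).1

theorem normalise (h : N.IsLeaf u x A) : N.normalise.IsLeaf u x A := by
  refine fun y B => ⟨fun hB => (h y B).1 hB.of_normalise, ?_⟩
  rintro ⟨rfl, rfl⟩
  obtain ⟨C, hC⟩ := h.links.exists_normalise
  obtain rfl := ((h _ _).1 hC.of_normalise).2
  exact hC

theorem addEdge (h : N.IsLeaf u x A) {a b : V} (ha : u ≠ a) (hb : u ≠ b) (B : Formula) :
    (N.addEdge a b B).IsLeaf u x A :=
  fun y C => (links_addEdge_of_ne ha hb).trans (h y C)

theorem removeEdge (h : N.IsLeaf u x A) {a b : V} (ha : u ≠ a) (hb : u ≠ b) :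
    (N.removeEdge a b).IsLeaf u x A :=
  fun y C => (links_removeEdge_of_ne ha hb).trans (h y C)

theorem comap {M : Net W} {f : V → W} (hf : f.Injective)
    (hlab : ∀ a b, N.lab a b = M.lab (f a) (f b)) (h : M.IsLeaf (f u) (f x) A) :
    N.IsLeaf u x A := fun y B => by
  rw [Links, hlab, hlab, ← hf.eq_iff]
  exact h (f y) B

theorem induce {S : Set V} (h : N.IsLeaf u x A) (hu : u ∈ S) (hx : x ∈ S) :
    (N.induce S).IsLeaf ⟨u, hu⟩ ⟨x, hx⟩ A :=
  comap Subtype.val_injective (fun _ _ => rfl) h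

theorem disjUnion_inl (h : N.IsLeaf u x A) (M : Net W) :
    (N.disjUnion M).IsLeaf (Sum.inl u) (Sum.inl x) A := by
  rintro (y | y) B
  · rw [Sum.inl.injEq]
    exact h y B
  · simp only [Links, disjUnion, reduceCtorEq, or_self, false_and]

theorem disjUnion_inr (h : N.IsLeaf u x A) (M : Net W) :
    (M.disjUnion N).IsLeaf (Sum.inr u) (Sum.inr x) A := by
  rintro (y | y) B
  · simp only [Links, disjUnion, reduceCtorEq, or_self, false_and]
  · rw [Sum.inr.injEq]
    exact h y B

end IsLeaf

namespace IsIsolated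

variable {N : Net V} {u : V}

theorem addEdge (h : N.IsIsolated u) {a b : V} (ha : u ≠ a) (hb : u ≠ b) (A : Formula) :
    (N.addEdge a b A).IsIsolated u :=
  fun v B hB => h v B ((links_addEdge_of_ne ha hb).1 hB)

theorem isLeaf_addEdge (h : N.IsIsolated u) {x : V} (hux : u ≠ x) (A : Formula) :
    (N.addEdge u x A).IsLeaf u x A := by
  intro y B
  have hin : N.lab y u ≠ some B.dual := fun hB => h y B (Or.inr hB)
  have hout : N.lab u y ≠ some B := fun hB => h y B (Or.inl hB)
  by_cases hy : y = x
  · simp [Links, Net.addEdge, hux, hy ▸ hin, hy, eq_comm]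
  · simp [Links, Net.addEdge, hux, hin, hout, hy]

theorem disjUnion_inl (h : N.IsIsolated u) (M : Net W) :
    (N.disjUnion M).IsIsolated (Sum.inl u) := by
  rintro (v | v) A hA
  · exact h v A hA
  · simp only [Links, disjUnion, reduceCtorEq, or_self] at hA

theorem disjUnion_inr (h : N.IsIsolated u) (M : Net W) :
    (M.disjUnion N).IsIsolated (Sum.inr u) := by
  rintro (v | v) A hA
  · simp only [Links, disjUnion, reduceCtorEq, or_self] at hA
  · exact h v A hA

end IsIsolated

theorem IsTree.isIsolated_of_subsingleton [Subsingleton V] {N : Net V} (hN : N.IsTree) (u : V) :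
    N.IsIsolated u :=
  fun v _ h => hN.ne_of_links h (Subsingleton.elim u v)

/-! ### Sides and branches of trees -/

theorem mem_side_of_adj {N : Net V} {v n x y : V} (hx : x ∈ N.side v n)
    (hxy : N.graph.Adj x y) (hne : s(x, y) ≠ s(v, n)) : y ∈ N.side v n :=
  SimpleGraph.Reachable.trans hx
    (SimpleGraph.Adj.reachable (SimpleGraph.deleteEdges_adj.2 ⟨hxy, hne⟩))

theorem mem_branch_of_adj {N : Net V} {v x y : V} {S : Set V} (hx : x ∈ N.branch v S)
    (hxy : N.graph.Adj x y) (hxv : x ≠ v) : y ∈ N.branch v S := by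
  obtain ⟨n, hn, hx⟩ := hx.resolve_left hxv
  refine or_iff_not_imp_left.2 fun hyv => ⟨n, hn, mem_side_of_adj hx hxy fun h => ?_⟩
  rcases Sym2.eq_iff.1 h with ⟨rfl, -⟩ | ⟨-, rfl⟩
  exacts [hxv rfl, hyv rfl]

theorem branch_empty (N : Net V) (v : V) : N.branch v ∅ = {v} := by
  simp only [branch, Set.mem_empty_iff_false, false_and, exists_false, or_false,
    Set.ofPred_eq_eq_singleton]

theorem IsTree.exists_mem_side {N : Net V} (hN : N.IsTree) {v u : V} (hu : u ≠ v) :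
    ∃ n, N.graph.Adj v n ∧ u ∈ N.side v n := by
  obtain ⟨p, hp⟩ := (hN.tree.connected.preconnected v u).exists_isPath
  cases p with
  | nil => exact absurd rfl hu
  | @cons _ n _ hvn q =>
    have hv : v ∉ q.support := (SimpleGraph.Walk.cons_isPath_iff hvn q).1 hp |>.2
    refine ⟨n, hvn, ⟨q.toDeleteEdges _ ?_⟩⟩
    rintro e he rfl
    exact hv (q.fst_mem_support_of_mem_edges he)

theorem IsTree.notMem_side {N : Net V} (hN : N.IsTree) {v n : V} (hvn : N.graph.Adj v n) :
    v ∉ N.side v n := fun hv =>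
  SimpleGraph.isBridge_iff.1
    (SimpleGraph.isAcyclic_iff_forall_adj_isBridge.1 hN.tree.isAcyclic hvn) hv.symm

theorem IsLeaf.eq_of_mem_side {N : Net V} {u x y : V} {A : Formula} (h : N.IsLeaf u x A)
    (hy : y ∈ N.side x u) : y = u := by
  obtain ⟨q⟩ := hy
  cases q with
  | nil => rfl
  | cons huz q =>
    obtain ⟨huz, hne⟩ := SimpleGraph.deleteEdges_adj.1 huz
    obtain rfl := h.eq_of_adj huz
    exact absurd Sym2.eq_swap hne

theorem graph_induce (N : Net V) (S : Set V) : (N.induce S).graph = N.graph.induce S := by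
  ext x y
  simp only [graph, induce, SimpleGraph.fromRel_adj, SimpleGraph.comap_adj, ne_eq,
    Subtype.ext_iff, Function.Embedding.subtype_apply]

theorem IsTree.induce {N : Net V} (hN : N.IsTree) {S : Set V}
    (hS : (N.graph.induce S).Connected) : (N.induce S).IsTree where
  finite := have := hN.finite; inferInstanceAs (Finite S)
  asymm x y := hN.asymm x y
  tree := by
    rw [graph_induce]
    exact ⟨hS, hN.tree.isAcyclic.induce S⟩

theorem IsTree.induce_branch_empty {N : Net V} (hN : N.IsTree) (v : V) :
    (N.induce (N.branch v ∅)).IsTree := by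
  rw [branch_empty]
  exact hN.induce SimpleGraph.Connected.of_subsingleton

theorem connected_induce_side (N : Net V) (v n : V) :
    (N.graph.induce (N.side v n)).Connected := by
  have hside : N.side v n =
      ((N.graph.deleteEdges {s(v, n)}).connectedComponentMk n).supp := by
    ext x
    exact SimpleGraph.reachable_comm.trans SimpleGraph.ConnectedComponent.eq.symm
  have hconn := ((N.graph.deleteEdges {s(v, n)}).connectedComponentMk n).connected_toSimpleGraph
  rw [hside]
  exact hconn.mono (SimpleGraph.comap_monotone _ (SimpleGraph.deleteEdges_le _))

/-! ### Trees joined by an edge -/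

/-- The net with the same edges in which each label `A` is replaced with `f A`. -/
def mapLabels (f : Formula → Formula) (N : Net V) : Net V where
  lab u v := (N.lab u v).map f

theorem isTree_mapLabels_iff {f : Formula → Formula} {N : Net V} :
    (N.mapLabels f).IsTree ↔ N.IsTree := by
  have hgraph : (N.mapLabels f).graph = N.graph := by
    simp only [graph, mapLabels, Option.isSome_map]
  have hasymm : ∀ u v, ((N.mapLabels f).lab u v).isSome → (N.mapLabels f).lab v u = none ↔
      (N.lab u v).isSome → N.lab v u = none := by
    simp only [mapLabels, Option.isSome_map, Option.map_eq_none_iff, implies_true]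
  refine ⟨fun h => ⟨h.finite, ?_, hgraph ▸ h.tree⟩, fun h => ⟨h.finite, ?_, hgraph ▸ h.tree⟩⟩
  · exact fun u v => (hasymm u v).1 (h.asymm u v)
  · exact fun u v => (hasymm u v).2 (h.asymm u v)

theorem isNormal_mapLabels_one (N : Net V) : (N.mapLabels fun _ => one).IsNormal := by
  intro u v A hA
  obtain ⟨-, -, rfl⟩ := Option.map_eq_some_iff.1 hA
  trivial

open Classical in
theorem mapLabels_addEdge (f : Formula → Formula) (N : Net V) (a b : V) (A : Formula) :
    (N.addEdge a b A).mapLabels f = (N.mapLabels f).addEdge a b (f A) :=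
  congrArg Net.mk (funext fun _ => funext fun _ => apply_ite (Option.map f) _ _ _)

theorem mapLabels_disjUnion (f : Formula → Formula) (M : Net V) (N : Net W) :
    (M.disjUnion N).mapLabels f = (M.mapLabels f).disjUnion (N.mapLabels f) := by
  refine congrArg Net.mk (funext fun x => funext fun y => ?_)
  rcases x with x | x <;> rcases y with y | y <;> rfl

/-- Being a tree does not depend on the labels, so that they can be made positive, as in
`RootedTree`. -/
theorem IsTree.disjUnion_addEdge {M : Net V} {N : Net W} (hM : M.IsTree) (hN : N.IsTree)
    (a : V) (b : W) (A : Formula) :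
    ((M.disjUnion N).addEdge (Sum.inl a) (Sum.inr b) A).IsTree := by
  rw [← isTree_mapLabels_iff (f := fun _ => one), mapLabels_addEdge, mapLabels_disjUnion]
  exact joinNet_isTree
    ⟨V, M.mapLabels fun _ => one, a, isTree_mapLabels_iff.2 hM, isNormal_mapLabels_one M⟩
    ⟨W, N.mapLabels fun _ => one, b, isTree_mapLabels_iff.2 hN, isNormal_mapLabels_one N⟩ one

theorem disjUnion_addEdge_inr (M : Net V) (N : Net W) (b c : W) (A : Formula) :
    M.disjUnion (N.addEdge b c A) = (M.disjUnion N).addEdge (Sum.inr b) (Sum.inr c) A := by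
  refine congrArg Net.mk (funext fun x => funext fun y => ?_)
  rcases x with x | x <;> rcases y with y | y <;> grind [addEdge, disjUnion]

theorem addEdge_comm_of_ne (N : Net V) {a b : V} (hab : a ≠ b) (c d : V) (A B : Formula) :
    (N.addEdge a c A).addEdge b d B = (N.addEdge b d B).addEdge a c A := by
  refine congrArg Net.mk (funext fun x => funext fun y => ?_)
  simp only [addEdge]
  split_ifs <;> grind

end Net

/-! ### Guarded nets -/

namespace SignedNet

/-- The invariant of the plays that start with a single proponent: each proponent hangs from an
opponent, either by an edge labelled with `⊥ ⊗ ⊥`, or by an edge labelled with `⊥` (in a position,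
an input edge labelled with `1`). In the second case the vertex cannot make any use of the token,
so it must not hold it, and another proponent must prevent the opponent from returning it. -/
def Guarded (N : SignedNet) : Prop :=
  ∀ u, N.sign u = Player.proponent → ∃ x, N.sign x = Player.opponent ∧
    (N.net.IsLeaf u x (tensor bot bot) ∨
      N.net.IsLeaf u x bot ∧ u ≠ N.token ∧ ∃ u' ≠ u, N.sign u' = Player.proponent)

theorem sign_ne_proponent_iff {N : SignedNet} {u : N.V} :
    N.sign u ≠ Player.proponent ↔ N.sign u = Player.opponent := by
  cases N.sign u <;> simp only [ne_eq, reduceCtorEq, not_true, not_false_eq_true]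

theorem ne_of_sign {N : SignedNet} {u v : N.V} (hu : N.sign u = Player.proponent)
    (hv : N.sign v = Player.opponent) : u ≠ v := by
  rintro rfl
  exact sign_ne_proponent_iff.2 hv hu

/-- In the case of a move from `N` to `M`, the map `f` sends each vertex to the one of which it is a
copy. -/
theorem Guarded.of_cover {M N : SignedNet} (hN : N.Guarded) (f : M.V → N.V)
    (hsign : ∀ z, M.sign z = N.sign (f z))
    (hsurj : ∀ u, N.sign u = Player.proponent → ∃ z, f z = u)
    (hleaf : ∀ z x A, M.sign z = Player.proponent → N.sign x = Player.opponent →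
      N.net.IsLeaf (f z) x A → ∃ x', f x' = x ∧ M.net.IsLeaf z x' A)
    (htoken : M.sign M.token = Player.proponent →
      f M.token = N.token ∨ ∃ x, N.net.Links (f M.token) x (tensor bot bot)) :
    M.Guarded := by
  intro z hz
  obtain ⟨x, hx, htensor | ⟨hbot, hne, u', hu', hsign'⟩⟩ := hN (f z) (hsign z ▸ hz)
  · obtain ⟨x', rfl, hx'⟩ := hleaf z x _ hz hx htensor
    exact ⟨x', hsign x' ▸ hx, Or.inl hx'⟩
  · obtain ⟨x', rfl, hx'⟩ := hleaf z x _ hz hx hbot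
    obtain ⟨z', rfl⟩ := hsurj u' hsign'
    refine ⟨x', hsign x' ▸ hx, Or.inr ⟨hx', ?_, z', ne_of_apply_ne f hu', hsign z' ▸ hsign'⟩⟩
    rintro rfl
    obtain h | ⟨y, hy⟩ := htoken hz
    · exact hne h
    · cases ((hbot _ _).1 hy).2

theorem Guarded.normalise {N : SignedNet} (hN : N.Guarded) : N.normalise.Guarded :=
  hN.of_cover id (fun _ => rfl) (fun u _ => ⟨u, rfl⟩) (fun _ x _ _ _ h => ⟨x, rfl, h.normalise⟩)
    fun _ => Or.inl rfl

theorem Guarded.of_iso {M N : SignedNet} (hN : N.Guarded) (h : M.Iso N) : M.Guarded := by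
  obtain ⟨e, hlab, hsign, htoken⟩ := h
  refine hN.of_cover e hsign (fun u _ => e.surjective u) (fun z x A _ _ hx => ?_)
    fun _ => Or.inl htoken
  obtain ⟨x, rfl⟩ := e.surjective x
  exact ⟨x, rfl, hx.comap e.injective hlab⟩

end SignedNet

namespace Position

open SignedNet

theorem Is.guarded {Q : Position} {N : SignedNet} (h : Q.Is N) (hN : N.Guarded) : Q.Guarded :=
  hN.normalise.of_iso h

section Guarded

variable {P : Position} (hP : P.Guarded) {v w : P.V} {A : Formula}

include hP

theorem isLeaf_of_lab_from_proponent (hv : P.sign v = Player.proponent)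
    (h : P.net.lab v w = some A) :
    A = tensor bot bot ∧ P.net.IsLeaf v w (tensor bot bot) ∧ P.sign w = Player.opponent := by
  obtain ⟨x, hx, hleaf | ⟨hleaf, -⟩⟩ := hP v hv
  · obtain ⟨rfl, rfl⟩ := (hleaf w A).1 (Or.inl h)
    exact ⟨rfl, hleaf, hx⟩
  · obtain ⟨rfl, rfl⟩ := (hleaf w A).1 (Or.inl h)
    exact (P.isNormal _ _ _ h).elim

theorem isLeaf_of_lab_to_proponent (hw : P.sign w = Player.proponent)
    (h : P.net.lab v w = some A) :
    A = one ∧ P.net.IsLeaf w v bot ∧ ∃ u ≠ w, P.sign u = Player.proponent := by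
  have hdual : P.net.Links w v A.dual := Net.links_dual_iff.2 (Or.inl h)
  have hA : ¬ A.dual.IsPositive := fun h' => (dual_isPositive_iff A).1 h' (P.isNormal _ _ _ h)
  obtain ⟨x, hx, hleaf | ⟨hleaf, -, hpartner⟩⟩ := hP w hw
  · exact absurd (((hleaf _ _).1 hdual).2 ▸ trivial) hA
  · obtain ⟨rfl, hbot⟩ := (hleaf _ _).1 hdual
    exact ⟨by rw [← dual_dual A, hbot, dual], hleaf, hpartner⟩

theorem sign_source_of_lab (h : P.net.lab v w = some A) (hA : A ≠ tensor bot bot) :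
    P.sign v = Player.opponent :=
  sign_ne_proponent_iff.1 fun hv => hA (isLeaf_of_lab_from_proponent hP hv h).1

theorem sign_target_of_lab (h : P.net.lab v w = some A) (hA : A ≠ one) :
    P.sign w = Player.opponent :=
  sign_ne_proponent_iff.1 fun hw => hA (isLeaf_of_lab_to_proponent hP hw h).1

/-! ### Moves preserve guardedness -/

theorem guarded_passTo_net (h : P.net.lab w P.token = some A) :
    (P.passTo P.net w).Guarded :=
  Guarded.of_cover hP id (fun _ => rfl) (fun u _ => ⟨u, rfl⟩) (fun _ x _ _ _ hx => ⟨x, rfl, hx⟩)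
    fun hw => Or.inr ⟨P.token, (isLeaf_of_lab_from_proponent hP hw h).2.1.links⟩

theorem guarded_passTo_removeEdge_addEdge {a b : P.V} (hv : P.sign v = Player.opponent)
    (hw : P.sign w = Player.opponent) (ha : P.sign a = Player.opponent)
    (hb : P.sign b = Player.opponent) (A : Formula) :
    (P.passTo ((P.net.removeEdge v w).addEdge a b A) w).Guarded :=
  Guarded.of_cover hP id (fun _ => rfl) (fun u _ => ⟨u, rfl⟩)
    (fun _ x _ hz _ hx => ⟨x, rfl, (hx.removeEdge (ne_of_sign hz hv) (ne_of_sign hz hw)).addEdge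
      (ne_of_sign hz ha) (ne_of_sign hz hb) A⟩)
    fun hw' => absurd hw (ne_of_eq_of_ne hw' Player.noConfusion)

theorem sign_target_of_lab_one (h : P.net.lab P.token w = some one)
    (hsole : ∀ x, P.net.graph.Adj P.token x → x = w) : P.sign w = Player.opponent := by
  refine sign_ne_proponent_iff.1 fun hw => ?_
  have htoken : P.sign P.token = Player.opponent := sign_source_of_lab hP h Formula.noConfusion
  obtain ⟨-, hleaf, u, hne, hu⟩ := isLeaf_of_lab_to_proponent hP hw h
  obtain ⟨n, hn, hside⟩ := P.isTree.exists_mem_side (ne_of_sign hu htoken)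
  obtain rfl := hsole n hn
  exact hne (hleaf.eq_of_mem_side hside)

theorem guarded_afterOne (h : P.net.lab P.token w = some one)
    (hsole : ∀ x, P.net.graph.Adj P.token x → x = w) (hne : w ≠ P.token) :
    (P.afterOne w hne).Guarded := by
  have htoken : P.sign P.token = Player.opponent := sign_source_of_lab hP h Formula.noConfusion
  have hw := sign_target_of_lab_one hP h hsole
  refine Guarded.of_cover hP Subtype.val (fun _ => rfl)
    (fun u hu => ⟨⟨u, ne_of_sign hu htoken⟩, rfl⟩) ?_
    fun hw' => absurd hw (ne_of_eq_of_ne hw' Player.noConfusion)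
  rintro ⟨u, hu⟩ x C hsign - hleaf
  have hx : x ≠ P.token := by
    rintro rfl
    have hadj := P.isTree.adj_of_links hleaf.links
    exact ne_of_sign (N := P.toSignedNet) hsign hw (hsole u hadj.symm)
  exact ⟨⟨x, hx⟩, rfl, hleaf.induce hu hx⟩

end Guarded

section Tensor

variable {P : Position} {w : P.V} {A B : Formula} {Γ Γ' Θ : Set P.V}

/-- The vertex of which a vertex of the target of a tensor move is a copy. -/
def afterTensorOrigin : (P.afterTensor w A B Γ Γ' Θ).V → P.V :=
  Sum.elim Subtype.val (Sum.elim Subtype.val Subtype.val)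

theorem sign_afterTensor (z : (P.afterTensor w A B Γ Γ' Θ).V) :
    (P.afterTensor w A B Γ Γ' Θ).sign z = P.sign (afterTensorOrigin z) := by
  rcases z with z | z | z <;> rfl

theorem exists_afterTensorOrigin_eq
    (hcover : Γ ∪ Γ' ∪ Θ = P.net.graph.neighborSet P.token \ {w}) {u : P.V}
    (hu : u ≠ P.token) : ∃ z : (P.afterTensor w A B Γ Γ' Θ).V, afterTensorOrigin z = u := by
  obtain ⟨n, hn, hside⟩ := P.isTree.exists_mem_side hu
  by_cases hnw : n = w
  · exact ⟨Sum.inr (Sum.inr ⟨u, hnw ▸ hside⟩), rfl⟩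
  · have hmem : n ∈ Γ ∪ Γ' ∪ Θ := hcover ▸ ⟨hn, hnw⟩
    rcases hmem with (hΓ | hΓ') | hΘ
    · exact ⟨Sum.inl ⟨u, Or.inr ⟨n, Or.inl hΓ, hside⟩⟩, rfl⟩
    · exact ⟨Sum.inr (Sum.inl ⟨u, Or.inr ⟨n, Or.inl hΓ', hside⟩⟩), rfl⟩
    · exact ⟨Sum.inl ⟨u, Or.inr ⟨n, Or.inr hΘ, hside⟩⟩, rfl⟩

theorem exists_isLeaf_afterTensor {z : (P.afterTensor w A B Γ Γ' Θ).V} {x : P.V} {C : Formula}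
    (hz : afterTensorOrigin z ≠ P.token) (hzw : afterTensorOrigin z ≠ w)
    (h : P.net.IsLeaf (afterTensorOrigin z) x C) :
    ∃ x', afterTensorOrigin x' = x ∧ (P.afterTensor w A B Γ Γ' Θ).net.IsLeaf z x' C := by
  suffices hcopy : ∃ x', afterTensorOrigin x' = x ∧
      ((P.net.induce (P.net.branch P.token (Γ ∪ Θ))).disjUnion
        ((P.net.induce (P.net.branch P.token (Γ' ∪ Θ))).disjUnion
          (P.net.induce (P.net.side P.token w)))).IsLeaf z x' C by
    obtain ⟨x', hx', hleaf⟩ := hcopy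
    refine ⟨x', hx', (hleaf.addEdge ?_ ?_ A).addEdge ?_ ?_ B⟩
    exacts [ne_of_apply_ne afterTensorOrigin hz, ne_of_apply_ne afterTensorOrigin hzw,
      ne_of_apply_ne afterTensorOrigin hz, ne_of_apply_ne afterTensorOrigin hzw]
  have hadj := P.isTree.adj_of_links h.links
  rcases z with ⟨u, hu⟩ | ⟨u, hu⟩ | ⟨u, hu⟩
  · have hx := Net.mem_branch_of_adj hu hadj hz
    exact ⟨Sum.inl ⟨x, hx⟩, rfl, (h.induce hu hx).disjUnion_inl _⟩
  · have hx := Net.mem_branch_of_adj hu hadj hz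
    exact ⟨Sum.inr (Sum.inl ⟨x, hx⟩), rfl, ((h.induce hu hx).disjUnion_inl _).disjUnion_inr _⟩
  · have hedge : s(u, x) ≠ s(P.token, w) := fun hedge => by
      rcases Sym2.eq_iff.1 hedge with ⟨hu', -⟩ | ⟨hu', -⟩
      exacts [hz hu', hzw hu']
    have hx := Net.mem_side_of_adj hu hadj hedge
    exact ⟨Sum.inr (Sum.inr ⟨x, hx⟩), rfl, ((h.induce hu hx).disjUnion_inr _).disjUnion_inr _⟩

theorem guarded_afterTensor_of_opponent (hP : P.Guarded)
    (htoken : P.sign P.token = Player.opponent) (hw : P.sign w = Player.opponent)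
    (hcover : Γ ∪ Γ' ∪ Θ = P.net.graph.neighborSet P.token \ {w}) :
    (P.afterTensor w A B Γ Γ' Θ).Guarded :=
  Guarded.of_cover hP afterTensorOrigin sign_afterTensor
    (fun _ hu => exists_afterTensorOrigin_eq hcover (ne_of_sign hu htoken))
    (fun z _ _ hz _ => exists_isLeaf_afterTensor
      (ne_of_sign (sign_afterTensor z ▸ hz) htoken) (ne_of_sign (sign_afterTensor z ▸ hz) hw))
    fun hw' => absurd hw (ne_of_eq_of_ne hw' Player.noConfusion)

theorem isTree_induce_branch_empty (P : Position) :
    (P.net.induce (P.net.branch P.token (∅ ∪ ∅))).IsTree := by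
  rw [Set.union_self]
  exact P.isTree.induce_branch_empty P.token

theorem isTree_afterTensor_empty (P : Position) (w : P.V) (A B : Formula) :
    (P.afterTensor w A B ∅ ∅ ∅).net.IsTree := by
  have hcopy := isTree_induce_branch_empty P
  have hside := P.isTree.induce (P.net.connected_induce_side P.token w)
  rw [afterTensor, Net.addEdge_comm_of_ne _ Sum.inl_ne_inr, ← Net.disjUnion_addEdge_inr]
  exact hcopy.disjUnion_addEdge (hcopy.disjUnion_addEdge hside _ _ B) _ _ A

theorem subsingleton_branch_empty (P : Position) :
    Subsingleton (P.net.branch P.token (∅ ∪ ∅)) := by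
  rw [Set.union_self, Net.branch_empty]
  infer_instance

theorem isIsolated_induce_branch_empty (P : Position) (u : P.net.branch P.token (∅ ∪ ∅)) :
    (P.net.induce (P.net.branch P.token (∅ ∪ ∅))).IsIsolated u :=
  have := subsingleton_branch_empty P
  (isTree_induce_branch_empty P).isIsolated_of_subsingleton u

theorem isLeaf_inl_afterTensor_empty (u : P.net.branch P.token (∅ ∪ ∅)) :
    (P.afterTensor w A B ∅ ∅ ∅).net.IsLeaf (Sum.inl u) (P.afterTensor w A B ∅ ∅ ∅).token A := by
  have := subsingleton_branch_empty P
  rw [Subsingleton.elim u ⟨P.token, P.net.root_mem_branch _ _⟩]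
  exact (((isIsolated_induce_branch_empty P _).disjUnion_inl _).isLeaf_addEdge
    Sum.inl_ne_inr A).addEdge Sum.inl_ne_inr Sum.inl_ne_inr B

theorem isLeaf_inr_inl_afterTensor_empty (u : P.net.branch P.token (∅ ∪ ∅)) :
    (P.afterTensor w A B ∅ ∅ ∅).net.IsLeaf (Sum.inr (Sum.inl u))
      (P.afterTensor w A B ∅ ∅ ∅).token B := by
  have := subsingleton_branch_empty P
  rw [Subsingleton.elim u ⟨P.token, P.net.root_mem_branch _ _⟩]
  exact ((((isIsolated_induce_branch_empty P _).disjUnion_inl _).disjUnion_inr _).addEdge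
    Sum.inr_ne_inl (Sum.inr_injective.ne Sum.inl_ne_inr) A).isLeaf_addEdge
    (Sum.inr_injective.ne Sum.inl_ne_inr) B

theorem guarded_afterTensor_of_proponent (hP : P.Guarded)
    (htoken : P.sign P.token = Player.proponent)
    (h : P.net.lab P.token w = some (tensor bot bot)) :
    (P.afterTensor w bot bot ∅ ∅ ∅).Guarded := by
  set M := P.afterTensor w bot bot ∅ ∅ ∅
  have hw : P.sign w = Player.opponent := sign_target_of_lab hP h Formula.noConfusion
  have hpartner (z : M.V) : ∃ z' ≠ z, M.sign z' = Player.proponent := by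
    let v : P.net.branch P.token (∅ ∪ ∅) := ⟨P.token, P.net.root_mem_branch _ _⟩
    by_cases hz : Sum.inl v = z
    · exact ⟨Sum.inr (Sum.inl v), hz ▸ Sum.inr_ne_inl, htoken⟩
    · exact ⟨Sum.inl v, hz, htoken⟩
  suffices hleaf : ∀ z, M.sign z = Player.proponent → ∃ x, M.sign x = Player.opponent ∧
      (M.net.IsLeaf z x (tensor bot bot) ∨ M.net.IsLeaf z x bot) from fun z hz =>
    let ⟨x, hx, hleaf⟩ := hleaf z hz
    ⟨x, hx, hleaf.imp_right fun hbot => ⟨hbot, ne_of_sign hz hw, hpartner z⟩⟩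
  rintro (u | u | ⟨u, hu⟩) hz
  · exact ⟨M.token, hw, Or.inr (isLeaf_inl_afterTensor_empty u)⟩
  · exact ⟨M.token, hw, Or.inr (isLeaf_inr_inl_afterTensor_empty u)⟩
  · have hutoken : u ≠ P.token := by
      rintro rfl
      exact P.isTree.notMem_side (P.isTree.adj_of_links (Or.inl h)) hu
    obtain ⟨x, hx, hleaf⟩ := hP u hz
    have hcopy (C : Formula) (hC : P.net.IsLeaf u x C) : ∃ x', M.sign x' = Player.opponent ∧
        M.net.IsLeaf (Sum.inr (Sum.inr ⟨u, hu⟩)) x' C := by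
      obtain ⟨x', rfl, hx'⟩ := exists_isLeaf_afterTensor (A := bot) (B := bot) (Γ := ∅) (Γ' := ∅)
        (Θ := ∅) (z := Sum.inr (Sum.inr ⟨u, hu⟩)) hutoken
        (ne_of_sign (N := P.toSignedNet) hz hw) hC
      exact ⟨x', sign_afterTensor x' ▸ hx, hx'⟩
    obtain hleaf | ⟨hleaf, -⟩ := hleaf
    · exact (hcopy _ hleaf).imp fun _ => And.imp_right Or.inl
    · exact (hcopy _ hleaf).imp fun _ => And.imp_right Or.inr

end Tensor

theorem exists_is {N : SignedNet} (h : N.net.IsTree) : ∃ Q : Position, Q.Is N :=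
  ⟨⟨N.normalise, h.normalise, N.net.normalise_isNormal⟩, Equiv.refl _, fun _ _ => rfl,
    fun _ => rfl, rfl⟩

section Move

variable {P : Position} (hP : P.Guarded)

include hP

theorem neighborSet_sdiff_eq_empty {w : P.V} {A : Formula}
    (htoken : P.sign P.token = Player.proponent) (h : P.net.lab P.token w = some A) :
    P.net.graph.neighborSet P.token \ {w} = ∅ :=
  Set.sdiff_eq_empty.2 fun _ => (isLeaf_of_lab_from_proponent hP htoken h).2.1.eq_of_adj

theorem guarded_of_move (Q : Position) (h : Move P Q) : Q.Guarded := by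
  cases h with
  | negative w A h hQ => exact hQ.guarded (guarded_passTo_net hP h)
  | one w h hsole hQ => exact hQ.guarded (guarded_afterOne hP h hsole _)
  | tensor w A B Γ Γ' Θ h hcover _ _ _ _ hQ =>
    refine hQ.guarded ?_
    have hw := sign_target_of_lab hP h Formula.noConfusion
    cases htoken : P.sign P.token with
    | opponent => exact guarded_afterTensor_of_opponent hP htoken hw hcover
    | proponent =>
      rw [neighborSet_sdiff_eq_empty hP htoken h, Set.union_empty_iff,
        Set.union_empty_iff] at hcover
      obtain ⟨⟨rfl, rfl⟩, rfl⟩ := hcover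
      cases (isLeaf_of_lab_from_proponent hP htoken h).1
      exact guarded_afterTensor_of_proponent hP htoken h
  | plusLeft w A B h hQ | plusRight w A B h hQ =>
    have htoken := sign_source_of_lab hP h Formula.noConfusion
    have htarget := sign_target_of_lab hP h Formula.noConfusion
    exact hQ.guarded
      (guarded_passTo_removeEdge_addEdge hP htoken htarget htoken htarget _)
  | whyNot w A n h hQ =>
    have htoken := sign_source_of_lab hP h Formula.noConfusion
    have hw := sign_target_of_lab hP h Formula.noConfusion
    exact hQ.guarded (guarded_passTo_removeEdge_addEdge hP htoken hw hw htoken _)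

theorem exists_move (htoken : P.active = Player.proponent) : ∃ Q, Move P Q := by
  obtain ⟨w, -, hleaf | ⟨-, hne, -⟩⟩ := hP P.token htoken
  · have hlab : P.net.lab P.token w = some (tensor bot bot) :=
      P.isNormal.lab_of_links hleaf.links trivial
    obtain ⟨Q, hQ⟩ := exists_is (isTree_afterTensor_empty P w bot bot)
    refine ⟨Q, Move.tensor w bot bot ∅ ∅ ∅ hlab ?_ disjoint_bot_left disjoint_bot_left
      disjoint_bot_left (fun _ => False.elim) hQ⟩
    rw [neighborSet_sdiff_eq_empty hP htoken hlab, Set.union_self, Set.union_self]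
  · exact absurd rfl hne

end Move

end Position

/-! ### Plays and strategies -/

theorem lastPosition_cons (U P : Position) (l : List Position) :
    lastPosition U (P :: l) = lastPosition P l :=
  List.getLastD_cons

namespace IsPlay

theorem invariant {I : Position → Prop} (hI : ∀ P, I P → ∀ Q, Move P Q → I Q) {U : Position}
    (hU : I U) {l : List Position} (hl : IsPlay U l) : I (lastPosition U l) := by
  induction l generalizing U with
  | nil => exact hU
  | cons P l ih =>
    obtain ⟨hUP, hl⟩ := List.isChain_cons_cons.1 hl
    exact lastPosition_cons U P l ▸ ih (hI U hU P hUP) hl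

theorem append_singleton {U Q : Position} {l : List Position} (hl : IsPlay U l)
    (hQ : Move (lastPosition U l) Q) : IsPlay U (l ++ [Q]) := by
  induction l generalizing U with
  | nil => exact List.isChain_cons_cons.2 ⟨hQ, List.isChain_singleton _⟩
  | cons P l ih =>
    obtain ⟨hUP, hl⟩ := List.isChain_cons_cons.1 hl
    exact List.isChain_cons_cons.2 ⟨hUP, ih hl (lastPosition_cons U P l ▸ hQ)⟩

end IsPlay

theorem isStrategy_setOf_isPlay (U : Position) : IsStrategy U {l | IsPlay U l} where
  isPlay _ hl := hl
  nil_mem := List.isChain_singleton _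
  prefix_mem _ hl _ hl' := List.IsChain.prefix hl ((List.prefix_cons_inj U).2 hl')
  welcoming _ hl _ _ hQ := IsPlay.append_singleton hl hQ
  iso_mem _ _ _ hl' _ := hl'

theorem isWinning_setOf_isPlay {I : Position → Prop} (hI : ∀ P, I P → ∀ Q, Move P Q → I Q)
    (hmove : ∀ P, I P → P.active = Player.proponent → ∃ Q, Move P Q) {U : Position} (hU : I U) :
    IsWinning U {l | IsPlay U l} := by
  refine ⟨isStrategy_setOf_isPlay U, fun l ⟨hl, hmax⟩ => ?_⟩
  refine SignedNet.sign_ne_proponent_iff.1 fun hactive => ?_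
  obtain ⟨Q, hQ⟩ := hmove _ (IsPlay.invariant hI hU hl) hactive
  have hextension := hmax _ (IsPlay.append_singleton hl hQ) (List.prefix_append l [Q])
  exact List.cons_ne_nil Q [] (List.append_right_eq_self.1 hextension)

/-! ### Validity of `⊥ ⊗ ⊥` -/

/-- The tree with one vertex. -/
def RootedTree.single : RootedTree where
  V := Unit
  net := ⟨fun _ _ => none⟩
  root := ()
  isTree := ⟨inferInstance, fun _ _ _ => rfl, SimpleGraph.IsTree.of_subsingleton⟩
  isNormal _ _ _ h := nomatch h

theorem guarded_initialPosition_single (T' : RootedTree) (t : RootedTree.single.V ⊕ T'.V) :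
    (initialPosition RootedTree.single T' (tensor bot bot) t).Guarded := by
  have hleaf : (joinNet RootedTree.single T' (tensor bot bot)).IsLeaf
      (Sum.inl RootedTree.single.root) (Sum.inr T'.root) (tensor bot bot) :=
    have : Subsingleton RootedTree.single.V := inferInstanceAs (Subsingleton Unit)
    ((RootedTree.single.isTree.isIsolated_of_subsingleton _).disjUnion_inl _).isLeaf_addEdge
      Sum.inl_ne_inr _
  rintro (u | u) hu
  · exact ⟨Sum.inr T'.root, rfl, Or.inl hleaf.normalise⟩
  · cases hu

theorem gLLTNValid_bot_tensor_bot : GLLTNValid (tensor bot bot) :=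
  ⟨RootedTree.single, fun T' t => ⟨_, isWinning_setOf_isPlay
    (fun _ hP => Position.guarded_of_move hP) (fun _ => Position.exists_move)
    (guarded_initialPosition_single T' t)⟩⟩

end LinLogic

theorem mainTheorem10 :
    (¬ ∀ A : LinLogic.Formula, LinLogic.GLLTNValid A → LinLogic.LLProvable [A]) ∧
    (¬ ∀ A : LinLogic.Formula, LinLogic.GLLTNValid A → LinLogic.LLTNProvable [A]) ∧
    LinLogic.GLLTNValid (LinLogic.Formula.tensor LinLogic.Formula.bot LinLogic.Formula.bot) ∧
    ¬ LinLogic.LLProvable [LinLogic.Formula.tensor LinLogic.Formula.bot LinLogic.Formula.bot] ∧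
    ¬ LinLogic.LLTNProvable
        [LinLogic.Formula.tensor LinLogic.Formula.bot LinLogic.Formula.bot] := by
  have hLL := LinLogic.not_llProvable_bot_tensor_bot
  have hLLTN := LinLogic.not_lltnProvable_bot_tensor_bot
  have hvalid := LinLogic.gLLTNValid_bot_tensor_bot
  exact ⟨fun hcomplete => hLL (hcomplete _ hvalid), fun hcomplete => hLLTN (hcomplete _ hvalid),
    hvalid, hLL, hLLTN⟩
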